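/- Let $X$ be a Polish space, $A \subseteq X$ an analytic set, $E$ a Borel equivalence relation on $X$, and $G$ a Borel treeing of $E$, that is, an acyclic graph on $X$ which is Borel as a subset of $X \times X$ and whose connected components are exactly the $E$-classes. Let $n \in \mathbb{N}$, and let $G^{\le n}$ denote the set of pairs $(y,z) \in X \times X$ for which there are $m \le n$ and a sequence $x_0, \dots, x_m$ with $x_0 = y$, $x_m = z$, and $(x_i, x_{i+1}) \in G$ for all $i < m$ (in particular, $y \mathrel{G^{\le n}} y$). For $Y, Z \subseteq X$, say that $Z$ is complete for $G^{\le n} \restriction Y$ if for every $y \in Y$ there is $z \in Z$ (not necessarily in $Y$) with $y \mathrel{G^{\le n}} z$. Suppose that for every $x \in A$ there is a countable set $C \subseteq [x]_E$ which is complete for $G^{\le n} \restriction [x]_{E \restriction A}$, where $[x]_{E \restriction A} = [x]_E \cap A$. Then there is a Borel set $B \subseteq X$ such that $B$ is complete for $G^{\le n} \restriction A$ and $E$ is countable on $B$, i.e., $[x]_E \cap B$ is countable for every $x \in B$. -/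

import Mathlib

namespace BorelTreeing

variable {X : Type*}

/-- The `n`-th iterate of a binary relation `R`: the pairs `(y, z)` for which there is a sequence
`x₀, …, xₙ` with `x₀ = y`, `xₙ = z` and `xᵢ R xᵢ₊₁` for all `i < n`. -/
def Iterate (R : X → X → Prop) (n : ℕ) (y z : X) : Prop :=
  ∃ p : Fin (n + 1) → X, p 0 = y ∧ p (Fin.last n) = z ∧ ∀ i : Fin n, R (p i.castSucc) (p i.succ)

/-- The relation `R^{≤ n}`: the union of the iterates `R^m` over `m ≤ n`. -/
def IterateLE (R : X → X → Prop) (n : ℕ) (y z : X) : Prop :=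
  ∃ m ≤ n, Iterate R m y z

/-- `Z ⊆ X` is complete for the restriction of `R` to `Y ⊆ X`: every point of `Y` is `R`-related
to a point of `Z`. (The point of `Z` is not required to belong to `Y`.) -/
def CompleteFor (R : X → X → Prop) (Y Z : Set X) : Prop :=
  ∀ y ∈ Y, ∃ z ∈ Z, R y z

/-- `E` is countable on `B`: all classes of the restriction of `E` to `B` are countable. -/
def CountableOn (E : Setoid X) (B : Set X) : Prop :=
  ∀ x ∈ B, {y | y ∈ B ∧ E x y}.Countable

/-- A treeing of `E`: an acyclic graph, Borel as a set of ordered pairs, whose connected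
components are the classes of `E`. -/
structure IsTreeing [MeasurableSpace X] (G : SimpleGraph X) (E : Setoid X) : Prop where
  borel : MeasurableSet {p : X × X | G.Adj p.1 p.2}
  acyclic : G.IsAcyclic
  reachable_iff : ∀ x y : X, G.Reachable x y ↔ E x y

end BorelTreeing

/-!
The theorem is proved by induction on `n`.

For `n = 0` the hypothesis says that the classes of `E` restricted to `A` are countable. The
analytic set `E ∩ (A × A)` then has countable sections, so it is covered by countably many Borel
graphs of partial functions (`AnalyticSet.exists_isCountableUnionOfGraphs`), and a separation
argument for squares (`AnalyticSet.exists_measurableSet_square_subset`) gives a Borel set `B ⊇ A`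
such that `E ∩ (B × B)` is covered by the same graphs.

For the step from `n` to `n + 1`, let `U` be the set of vertices `z` with uncountably many
neighbours `w` which begin a geodesic of length `n + 1` from `z` to a point of `A`. If a countable
set `C` of centres serves the class of `z`, then `z ∈ C`: by acyclicity, a centre other than `z`
serves at most one of these branches (`mem_of_not_countable_firstSteps`). Hence `E` is countable
on `U`. As `U` is analytic (`AnalyticSet.setOf_not_countable_section`), the case `n = 0` gives a
Borel set `B₁ ⊇ U` on which `E` is countable. The points within distance `n + 1` of `B₁` form a
Borel set by the Lusin–Novikov theorem, and may be removed from `A`. For the remaining points,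
every centre `c` has only countably many first steps towards points at distance `n + 1`; adding
these to `C` gives a countable set of centres for the radius `n`, and the induction hypothesis
applies.

The descriptive set theory rests on one notion. Parametrize an analytic subset of `X × Y` by a
continuous map `(u, v)` from a Polish space `Z`. Its section over `x` is uncountable if and only if
there is a sequence `d` in `Z` over `x` each of whose terms is a limit of terms with other
ordinates (`IsSplittingSequence`). This condition is visibly analytic in `x`. If the set is not
covered by countably many Borel graphs, such a sequence is obtained as a limit of finite tuples
over a common point of `X`, built one point at a time: the tuples under consideration always form
an analytic set outside the σ-ideal `IsSmall`, and this property survives the splitting of any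
coordinate (`not_isSmall_splitting`, `exists_isSplittingSequence_of_not_isSmall`).
-/

open Set Topology MeasureTheory Filter

namespace BorelTreeing

/-! ### Countable unions of Borel graphs -/

/-- A subset of `X × Y` which is the union of countably many Borel graphs of partial functions
from `X` to `Y`. -/
def IsCountableUnionOfGraphs {X Y : Type*} [MeasurableSpace X] [MeasurableSpace Y]
    (Q : Set (X × Y)) : Prop :=
  ∃ F : ℕ → Set (X × Y), (∀ k, MeasurableSet (F k) ∧ InjOn Prod.fst (F k)) ∧ Q = ⋃ k, F k

namespace IsCountableUnionOfGraphs

variable {X Y : Type*} [MeasurableSpace X] [MeasurableSpace Y]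

theorem measurableSet {Q : Set (X × Y)} (hQ : IsCountableUnionOfGraphs Q) : MeasurableSet Q := by
  obtain ⟨F, hF, rfl⟩ := hQ
  exact MeasurableSet.iUnion fun k => (hF k).1

theorem of_graph {Q : Set (X × Y)} (hQ : MeasurableSet Q) (hinj : InjOn Prod.fst Q) :
    IsCountableUnionOfGraphs Q :=
  ⟨fun _ => Q, fun _ => ⟨hQ, hinj⟩, (iUnion_const Q).symm⟩

theorem iUnion {ι : Type*} [Countable ι] {Q : ι → Set (X × Y)}
    (hQ : ∀ i, IsCountableUnionOfGraphs (Q i)) : IsCountableUnionOfGraphs (⋃ i, Q i) := by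
  choose F hF hQF using hQ
  rcases isEmpty_or_nonempty (ι × ℕ) with h | h
  · have : IsEmpty ι := by simpa using h
    rw [iUnion_of_empty]
    exact of_graph MeasurableSet.empty (injOn_empty _)
  · obtain ⟨e, he⟩ := exists_surjective_nat (ι × ℕ)
    refine ⟨fun k => F (e k).1 (e k).2, fun k => hF _ _, ?_⟩
    rw [he.iUnion_comp fun p : ι × ℕ => F p.1 p.2, iUnion_prod']
    exact iUnion_congr hQF

theorem union {Q R : Set (X × Y)} (hQ : IsCountableUnionOfGraphs Q)
    (hR : IsCountableUnionOfGraphs R) : IsCountableUnionOfGraphs (Q ∪ R) := by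
  rw [union_eq_iUnion]
  exact iUnion fun b => by cases b <;> assumption

theorem inter {Q R : Set (X × Y)} (hQ : IsCountableUnionOfGraphs Q) (hR : MeasurableSet R) :
    IsCountableUnionOfGraphs (R ∩ Q) := by
  obtain ⟨F, hF, rfl⟩ := hQ
  exact ⟨fun k => R ∩ F k, fun k => ⟨hR.inter (hF k).1, (hF k).2.mono inter_subset_right⟩,
    inter_iUnion _ _⟩

theorem countable_section {Q : Set (X × Y)} (hQ : IsCountableUnionOfGraphs Q) (x : X) :
    {y | (x, y) ∈ Q}.Countable := by
  obtain ⟨F, hF, rfl⟩ := hQ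
  have : {y | (x, y) ∈ ⋃ k, F k} = ⋃ k, {y | (x, y) ∈ F k} := by ext; simp
  rw [this]
  refine countable_iUnion fun k => Set.Subsingleton.countable fun y hy z hz => ?_
  exact congrArg Prod.snd ((hF k).2 hy hz rfl)

theorem measurableSet_image_fst [StandardBorelSpace X] [StandardBorelSpace Y]
    {Q : Set (X × Y)} (hQ : IsCountableUnionOfGraphs Q) : MeasurableSet (Prod.fst '' Q) := by
  obtain ⟨F, hF, rfl⟩ := hQ
  rw [image_iUnion]
  exact MeasurableSet.iUnion fun k => (hF k).1.image_of_measurable_injOn measurable_fst (hF k).2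

end IsCountableUnionOfGraphs

theorem AnalyticSet.inter {S : Type*} [TopologicalSpace S] [T2Space S] {s t : Set S}
    (hs : AnalyticSet s) (ht : AnalyticSet t) : AnalyticSet (s ∩ t) := by
  rw [inter_eq_iInter]
  exact AnalyticSet.iInter fun b => by cases b <;> assumption

/-- A separation theorem for squares: apply Lusin separation in each of the two variables. -/
theorem AnalyticSet.exists_measurableSet_square_subset {S : Type*} [TopologicalSpace S]
    [PolishSpace S] [MeasurableSpace S] [BorelSpace S] {W : Set S} (hW : AnalyticSet W)
    {R : Set (S × S)} (hR : MeasurableSet R) (hWR : W ×ˢ W ⊆ R) :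
    ∃ B, MeasurableSet B ∧ W ⊆ B ∧ B ×ˢ B ⊆ R := by
  have h₁ : AnalyticSet (Prod.fst '' (Rᶜ ∩ Prod.snd ⁻¹' W)) :=
    (AnalyticSet.inter hR.compl.analyticSet
      (hW.preimage continuous_snd)).image_of_continuous continuous_fst
  obtain ⟨B₀, hWB₀, hB₀, hB₀m⟩ := hW.measurablySeparable h₁ <| by
    rw [disjoint_left]
    rintro x hx ⟨⟨x, y⟩, ⟨hxy, hy⟩, rfl⟩
    exact hxy (hWR ⟨hx, hy⟩)
  have h₂ : AnalyticSet (Prod.snd '' (Rᶜ ∩ Prod.fst ⁻¹' B₀)) :=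
    (hR.compl.inter (measurable_fst hB₀m)).analyticSet.image_of_continuous continuous_snd
  obtain ⟨B₁, hWB₁, hB₁, hB₁m⟩ := hW.measurablySeparable h₂ <| by
    rw [disjoint_left]
    rintro y hy ⟨⟨x, y⟩, ⟨hxy, hx⟩, rfl⟩
    exact disjoint_left.1 hB₀ ⟨(x, y), ⟨hxy, hy⟩, rfl⟩ hx
  refine ⟨B₀ ∩ B₁, hB₀m.inter hB₁m, subset_inter hWB₀ hWB₁, ?_⟩
  rintro ⟨x, y⟩ ⟨⟨hx, -⟩, ⟨-, hy⟩⟩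
  by_contra hxy
  exact disjoint_left.1 hB₁ ⟨(x, y), ⟨hxy, hx⟩, rfl⟩ hy

/-- An analytic graph of a partial function is contained in a Borel one. -/
theorem AnalyticSet.exists_measurableSet_graph_superset {X Y : Type*} [TopologicalSpace X]
    [PolishSpace X] [MeasurableSpace X] [BorelSpace X] [TopologicalSpace Y]
    [PolishSpace Y] [MeasurableSpace Y] [BorelSpace Y] {W : Set (X × Y)} (hW : AnalyticSet W)
    (hinj : InjOn Prod.fst W) : ∃ F, MeasurableSet F ∧ W ⊆ F ∧ InjOn Prod.fst F := by
  have hR : MeasurableSet {p : (X × Y) × (X × Y) | p.1.1 = p.2.1 → p.1 = p.2} := by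
    have h₁ : MeasurableSet {p : (X × Y) × (X × Y) | p.1.1 = p.2.1} :=
      measurableSet_eq_fun (by fun_prop) (by fun_prop)
    have h₂ : MeasurableSet {p : (X × Y) × (X × Y) | p.1 = p.2} :=
      measurableSet_eq_fun measurable_fst measurable_snd
    exact h₁.imp h₂
  obtain ⟨F, hF, hWF, hFR⟩ := AnalyticSet.exists_measurableSet_square_subset hW hR
    fun p hp h => hinj hp.1 hp.2 h
  exact ⟨F, hF, hWF, fun p hp q hq h => hFR (mk_mem_prod hp hq) h⟩

/-! ### Distances in acyclic graphs -/

section Graph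

variable {V : Type*} {G : SimpleGraph V}

theorem dist_add_dist_le_length {u v x : V} (p : G.Walk u v) (hx : x ∈ p.support) :
    G.dist u x + G.dist x v ≤ p.length := by
  classical
  have h := congrArg SimpleGraph.Walk.length (p.take_spec hx)
  rw [SimpleGraph.Walk.length_append] at h
  have h₁ := SimpleGraph.dist_le (p.takeUntil x hx)
  have h₂ := SimpleGraph.dist_le (p.dropUntil x hx)
  lia

theorem length_eq_dist_of_isPath (hG : G.IsAcyclic) {u v : V} {p : G.Walk u v} (hp : p.IsPath) :
    p.length = G.dist u v := by
  obtain ⟨q, hq, hqd⟩ := p.reachable.exists_path_of_dist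
  rw [← hqd]
  exact congrArg (fun r : G.Path u v => r.1.length) 
    ((hG.subsingleton_path u v).elim ⟨p, hp⟩ ⟨q, hq⟩)

/-- The two ends of an edge of a forest are never at the same distance from a third vertex. -/
theorem dist_eq_add_one_or (hG : G.IsAcyclic) {z w c : V} (hzw : G.Adj z w)
    (hc : G.Reachable z c) : G.dist z c = G.dist w c + 1 ∨ G.dist w c = G.dist z c + 1 := by
  obtain ⟨p, hp, hpd⟩ := hc.exists_path_of_dist
  by_cases hw : w ∈ p.support
  · left
    have h₁ := dist_add_dist_le_length p hw
    have h₂ := hzw.reachable.dist_triangle_left c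
    rw [SimpleGraph.dist_eq_one_iff_adj.2 hzw] at h₁ h₂
    lia
  · right
    rw [← length_eq_dist_of_isPath hG (SimpleGraph.Walk.IsPath.cons hp hw (h := hzw.symm)),
      SimpleGraph.Walk.length_cons, hpd]

/-- If `a` and `c` lie on opposite sides of the edge `zw` of a forest, then the geodesic from `a`
to `c` crosses this edge. -/
theorem dist_add_dist_le_of_opposite_sides (hG : G.IsAcyclic) {z w a c : V} (hzw : G.Adj z w)
    (ha : G.Reachable z a) (hc : G.Reachable z c) (hza : G.dist z a = G.dist w a + 1)
    (hwc : G.dist w c = G.dist z c + 1) : G.dist z a + G.dist z c ≤ G.dist a c := by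
  obtain ⟨q, hq⟩ := (ha.symm.trans hc).exists_walk_length_eq_dist
  obtain ⟨r, hr⟩ := hc.exists_walk_length_eq_dist
  obtain ⟨s, hs⟩ := (ha.symm.trans hzw.reachable).exists_walk_length_eq_dist
  have hbr := SimpleGraph.isBridge_iff_forall_walk_mem_edges.1
    (SimpleGraph.isAcyclic_iff_forall_isBridge.1 hG hzw)
    (r.append (q.reverse.append s))
  have hqz : z ∈ q.support := by
    simp only [SimpleGraph.Walk.edges_append, SimpleGraph.Walk.edges_reverse, List.mem_append,
      List.mem_reverse] at hbr
    rcases hbr with h | h | h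
    · have := dist_add_dist_le_length r (r.snd_mem_support_of_mem_edges h)
      lia
    · exact q.fst_mem_support_of_mem_edges h
    · have := dist_add_dist_le_length s (s.fst_mem_support_of_mem_edges h)
      rw [G.dist_comm (u := a) (v := z), G.dist_comm (u := a) (v := w)] at *
      lia
  have := dist_add_dist_le_length q hqz
  rw [G.dist_comm (u := a) (v := z)] at this
  lia

/-- The first step of a geodesic in a forest is unique. -/
theorem eq_of_dist_eq_add_one (hG : G.IsAcyclic) {z w w' c : V} (hw : G.Adj z w)
    (hw' : G.Adj z w') (hc : G.Reachable z c) (h : G.dist z c = G.dist w c + 1)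
    (h' : G.dist z c = G.dist w' c + 1) : w = w' := by
  by_contra hne
  have hzw' : G.dist z w' = 1 := SimpleGraph.dist_eq_one_iff_adj.2 hw'
  have hr : G.Reachable w w' := hw.symm.reachable.trans hw'.reachable
  have hpos := hr.pos_dist_of_ne hne
  rcases dist_eq_add_one_or hG hw hw'.reachable with h₁ | h₁
  · lia
  · have := dist_add_dist_le_of_opposite_sides hG hw hc hw'.reachable h h₁
    rw [G.dist_comm (u := c)] at this
    lia

theorem exists_adj_dist_eq_add_one {z c : V} {m : ℕ} (hc : G.Reachable z c)
    (h : G.dist z c = m + 1) : ∃ w, G.Adj z w ∧ G.dist w c = m := by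
  obtain ⟨p, hp⟩ := hc.exists_walk_length_eq_dist
  cases p with
  | nil => simp at h
  | cons hzw q =>
    refine ⟨_, hzw, ?_⟩
    have h₁ := SimpleGraph.dist_le q
    have h₂ := hzw.reachable.dist_triangle_left c
    rw [SimpleGraph.dist_eq_one_iff_adj.2 hzw] at h₂
    rw [SimpleGraph.Walk.length_cons] at hp
    lia

theorem iterateLE_adj_iff {n : ℕ} {y z : V} :
    IterateLE G.Adj n y z ↔ G.Reachable y z ∧ G.dist y z ≤ n := by
  constructor
  · rintro ⟨m, hm, p, rfl, rfl, hp⟩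
    have key : ∀ i : Fin (m + 1), ∃ q : G.Walk (p 0) (p i), q.length = i := by
      intro i
      induction i using Fin.induction with
      | zero => exact ⟨.nil, rfl⟩
      | succ i ih =>
        obtain ⟨q, hq⟩ := ih
        exact ⟨q.concat (hp i), by simp [hq]⟩
    obtain ⟨q, hq⟩ := key (Fin.last m)
    refine ⟨q.reachable, (SimpleGraph.dist_le q).trans ?_⟩
    simpa [hq] using hm
  · rintro ⟨hr, hd⟩
    obtain ⟨q, hq⟩ := hr.exists_walk_length_eq_dist
    refine ⟨q.length, hq ▸ hd, fun i => q.getVert i, by simp, by simp, fun i => ?_⟩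
    simpa using q.adj_getVert_succ i.2

end Graph

/-- The distance in a Borel treeing is Borel: the next vertex on a geodesic is unique, so each
level set of the distance is an injective projection of a Borel set. -/
theorem IsTreeing.measurableSet_dist_eq {X : Type*} [MeasurableSpace X] [StandardBorelSpace X]
    {G : SimpleGraph X} {E : Setoid X} (hG : IsTreeing G E) (m : ℕ) :
    MeasurableSet {p : X × X | G.Reachable p.1 p.2 ∧ G.dist p.1 p.2 = m} := by
  induction m using Nat.strong_induction_on with
  | _ m ih =>
  cases m with
  | zero =>
    convert measurableSet_eq_fun (measurable_fst (α := X) (β := X)) measurable_snd using 1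
    ext p
    constructor
    · rintro ⟨h, h'⟩
      exact h.dist_eq_zero_iff.1 h'
    · rintro (h : p.1 = p.2)
      simp [h]
  | succ m =>
    let D : ℕ → Set (X × X) := fun k => {p | G.Reachable p.1 p.2 ∧ G.dist p.1 p.2 = k}
    let T : Set ((X × X) × X) := {t | G.Adj t.1.1 t.2 ∧ (t.2, t.1.2) ∈ D m ∧
      ∀ k ∈ Finset.range (m + 1), t.1 ∉ D k}
    have hTd : ∀ t ∈ T, G.Reachable t.1.1 t.1.2 ∧ G.dist t.1.1 t.1.2 = m + 1 := by
      rintro ⟨⟨y, z⟩, w⟩ ⟨hyw, ⟨hr, hd⟩, hn⟩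
      dsimp only at *
      have hyz := hyw.reachable.trans hr
      refine ⟨hyz, ?_⟩
      have hk := fun k hk h => hn k (Finset.mem_range.2 hk) ⟨hyz, h⟩
      rcases dist_eq_add_one_or hG.acyclic hyw hyz with h | h
      · lia
      · exact (hk (G.dist y z) (by lia) rfl).elim
    have hT : MeasurableSet T := by
      refine MeasurableSet.inter (hG.borel.preimage (f := fun t : (X × X) × X => (t.1.1, t.2))
        (by fun_prop)) (MeasurableSet.inter ((ih m (by lia)).preimage
          (f := fun t : (X × X) × X => (t.2, t.1.2)) (by fun_prop)) ?_)
      simp only [← mem_compl_iff]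
      refine MeasurableSet.congr (s := ⋂ k ∈ Finset.range (m + 1), Prod.fst ⁻¹' (D k)ᶜ) ?_ ?_
      · exact Finset.measurableSet_biInter _ fun k hk =>
          (ih k (by simpa using hk)).compl.preimage measurable_fst
      · ext t
        exact mem_iInter₂
    convert hT.image_of_measurable_injOn measurable_fst ?_ using 1
    · ext ⟨y, z⟩
      constructor
      · rintro ⟨hr, hd⟩
        obtain ⟨w, hw, hwd⟩ := exists_adj_dist_eq_add_one hr hd
        refine ⟨((y, z), w), ⟨hw, ⟨hw.symm.reachable.trans hr, hwd⟩, fun k hk h => ?_⟩, rfl⟩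
        have := h.2.symm.trans hd
        simp at hk
        lia
      · rintro ⟨t, ht, h⟩
        have := hTd t ht
        rwa [h] at this
    · rintro ⟨p, w⟩ ht ⟨p', w'⟩ ht' (rfl : p = p')
      have h := hTd _ ht
      refine Prod.ext rfl (eq_of_dist_eq_add_one hG.acyclic ht.1 ht'.1 h.1 ?_ ?_)
      · rw [h.2, ht.2.1.2]
      · rw [h.2, ht'.2.1.2]

/-! ### Analytic sets with countable sections -/

section Sections

variable {X Y Z : Type*}

variable [TopologicalSpace X] [MetricSpace Y] [MetricSpace Z] {u : Z → X} {v : Z → Y}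

/-- A sequence in `Z` lying over `x` and witnessing that the section over `x` of the image of
`(u, v)` is uncountable: each of its terms is a limit of terms with other ordinates. -/
structure IsSplittingSequence (u : Z → X) (v : Z → Y) (x : X) (d : ℕ → Z) : Prop where
  eq : ∀ i, u (d i) = x
  exists_near : ∀ i q : ℕ, ∃ j, dist (d j) (d i) < 1 / ((q : ℝ) + 1) ∧ v (d j) ≠ v (d i)

/-- A Baire category argument: the fibres of `v` are nowhere dense in the closure of a splitting
sequence. -/
theorem IsSplittingSequence.not_countable [T1Space X] [CompleteSpace Z] (hu : Continuous u) (hv : Continuous v) {x : X}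
    {d : ℕ → Z} (hd : IsSplittingSequence u v x d) : ¬ {y | ∃ z, u z = x ∧ v z = y}.Countable := by
  intro hc
  let K := closure (range d)
  have hKx : ∀ z ∈ K, u z = x := fun z hz =>
    closure_minimal (range_subset_iff.2 hd.eq) (isClosed_singleton.preimage hu) hz
  have := (isClosed_closure (s := range d)).isComplete.completeSpace_coe
  have : Nonempty K := ⟨⟨d 0, subset_closure (mem_range_self 0)⟩⟩
  have := hc.to_subtype
  have hcover : ⋃ y : {y | ∃ z, u z = x ∧ v z = y}, {z : K | v z = y} = univ :=
    eq_univ_of_forall fun z => mem_iUnion.2 ⟨⟨v z, z, hKx z z.2, rfl⟩, rfl⟩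
  have hclosed : ∀ y : {y | ∃ z, u z = x ∧ v z = y}, IsClosed {z : K | v z = y} :=
    fun y => isClosed_eq (by fun_prop) continuous_const
  obtain ⟨⟨y, _⟩, hy⟩ := nonempty_interior_of_iUnion_of_closed hclosed hcover
  obtain ⟨O, hO, hOi⟩ := isOpen_induced_iff.1 (isOpen_interior (s := {z : K | v z = y}))
  obtain ⟨z, hz⟩ := hy
  have hOy : ∀ i, d i ∈ O → v (d i) = y := fun i hi =>
    interior_subset (s := {z : K | v z = y}) (hOi.subset
      (show (⟨d i, subset_closure (mem_range_self i)⟩ : K) ∈ Subtype.val ⁻¹' O from hi))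
  obtain ⟨_, hiO, i, rfl⟩ := mem_closure_iff.1 z.2 O hO (hOi.superset hz)
  obtain ⟨η, hη, hball⟩ := Metric.isOpen_iff.1 hO _ hiO
  obtain ⟨q, hq⟩ := exists_nat_one_div_lt hη
  obtain ⟨j, hj, hne⟩ := hd.exists_near i q
  exact hne ((hOy j (hball (hj.trans hq))).trans (hOy i hiO).symm)

omit [TopologicalSpace X] in
/-- Conversely, an uncountable section has a splitting sequence: a dense sequence in the set of
points all of whose neighbourhoods have uncountable image. -/
theorem exists_isSplittingSequence [SecondCountableTopology Z] (hv : Continuous v) {x : X}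
    (hc : ¬ {y | ∃ z, u z = x ∧ v z = y}.Countable) : ∃ d, IsSplittingSequence u v x d := by
  let b := TopologicalSpace.countableBasis Z
  let S : Set Z := {z | u z = x}
  let N : Set (Set Z) := {O ∈ b | (v '' (S ∩ O)).Countable}
  have hN : N.Countable := (TopologicalSpace.countable_countableBasis Z).mono (sep_subset _ _)
  let P : Set Z := S \ ⋃₀ N
  have hNc : (v '' (S ∩ ⋃₀ N)).Countable := by
    rw [sUnion_eq_biUnion, inter_iUnion₂, image_iUnion₂]
    exact hN.biUnion fun O hO => hO.2
  have hlocal : ∀ O, IsOpen O → (P ∩ O).Nonempty → ¬ (v '' (P ∩ O)).Countable := by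
    rintro O hO ⟨z, hz, hzO⟩ hcount
    obtain ⟨O', hO'b, hzO', hO'O⟩ :=
      (TopologicalSpace.isBasis_countableBasis Z).exists_subset_of_mem_open hzO hO
    refine hz.2 ⟨O', ⟨hO'b, (hcount.union hNc).mono ?_⟩, hzO'⟩
    rintro _ ⟨w, ⟨hwS, hwO'⟩, rfl⟩
    by_cases hw : w ∈ ⋃₀ N
    · exact .inr ⟨w, ⟨hwS, hw⟩, rfl⟩
    · exact .inl ⟨w, ⟨⟨hwS, hw⟩, hO'O hwO'⟩, rfl⟩
  have hPne : P.Nonempty := by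
    rw [nonempty_iff_ne_empty]
    intro hP
    refine hc (hNc.mono ?_)
    rintro _ ⟨z, hz, rfl⟩
    exact ⟨z, ⟨hz, sdiff_eq_empty.1 hP hz⟩, rfl⟩
  have : Nonempty P := hPne.to_subtype
  let e := TopologicalSpace.denseSeq P
  refine ⟨fun i => e i, fun i => (e i).2.1, fun i q => ?_⟩
  let O := Metric.ball (e i : Z) (1 / ((q : ℝ) + 1))
  have hO := hlocal O Metric.isOpen_ball ⟨e i, (e i).2, Metric.mem_ball_self (by positivity)⟩
  obtain ⟨z, ⟨hzP, hzO⟩, hzv⟩ : ∃ z ∈ P ∩ O, v z ≠ v (e i) := by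
    by_contra! h
    refine hO ((countable_singleton (v (e i))).mono ?_)
    rintro _ ⟨z, hz, rfl⟩
    exact h z hz
  have hopen : IsOpen {w : P | (w : Z) ∈ O ∧ v w ≠ v (e i)} :=
    (Metric.isOpen_ball.preimage continuous_subtype_val).inter
      (isOpen_ne_fun (by fun_prop) continuous_const)
  obtain ⟨j, hj⟩ := (TopologicalSpace.denseRange_denseSeq P).exists_mem_open hopen
    ⟨⟨z, hzP⟩, hzO, hzv⟩
  exact ⟨j, hj⟩

/-- A set `H` of sequences in `Z` is small, with respect to the coordinates below `m` and to the
parametrization `(u, v) : Z → X × Y`, if some countable union of Borel graphs catches, for each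
sequence in `H`, the image of at least one of these coordinates. Only the first `m` coordinates
matter; sequences are used in place of `m`-tuples to keep a single ambient space. -/
def IsSmall [MeasurableSpace X] [MeasurableSpace Y] (u : Z → X) (v : Z → Y) (m : ℕ)
    (H : Set (ℕ → Z)) : Prop :=
  ∃ Q, IsCountableUnionOfGraphs Q ∧ ∀ α ∈ H, ∃ i < m, (u (α i), v (α i)) ∈ Q

omit [TopologicalSpace X] [MetricSpace Y] [MetricSpace Z] in
theorem IsSmall.of_iUnion [MeasurableSpace X] [MeasurableSpace Y] {u : Z → X} {v : Z → Y} {m : ℕ}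
    {ι : Type*} [Countable ι] {H : Set (ℕ → Z)} {K : ι → Set (ℕ → Z)}
    (hK : ∀ i, IsSmall u v m (K i)) (hHK : H ⊆ ⋃ i, K i) : IsSmall u v m H := by
  choose Q hQ hKQ using hK
  refine ⟨_, .iUnion hQ, fun α hα => ?_⟩
  obtain ⟨i, hi⟩ := mem_iUnion.1 (hHK hα)
  obtain ⟨j, hj, h⟩ := hKQ i α hi
  exact ⟨j, hj, mem_iUnion.2 ⟨i, h⟩⟩

omit [TopologicalSpace X] [MetricSpace Y] [MetricSpace Z] in
theorem nonempty_of_not_isSmall [MeasurableSpace X] [MeasurableSpace Y] {u : Z → X} {v : Z → Y}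
    {m : ℕ} {H : Set (ℕ → Z)} (hH : ¬ IsSmall u v m H) : H.Nonempty := by
  rw [nonempty_iff_ne_empty]
  rintro rfl
  exact hH ⟨∅, .of_graph .empty (injOn_empty _), by simp⟩

/-- The tuples obtained from a pair of tuples in `H` over the same point of `X`, with distinct
`t`-th ordinates, by appending the `t`-th coordinate of the second one to the first one. -/
def splitting (u : Z → X) (v : Z → Y) (m t : ℕ) (H : Set (ℕ → Z)) : Set (ℕ → Z) :=
  (fun p : (ℕ → Z) × (ℕ → Z) => Function.update p.1 m (p.2 t)) ''
    {p | (p.1 ∈ H ∧ p.2 ∈ H) ∧ u (p.1 t) = u (p.2 t) ∧ v (p.1 t) ≠ v (p.2 t)}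

theorem analyticSet_splitting [T2Space X] [SecondCountableTopology Z] [CompleteSpace Z] (hu : Continuous u) (hv : Continuous v) {m t : ℕ}
    {H : Set (ℕ → Z)} (hH : AnalyticSet H) : AnalyticSet (splitting u v m t H) := by
  borelize Z
  refine AnalyticSet.image_of_continuous (AnalyticSet.inter
    (AnalyticSet.inter (hH.preimage continuous_fst) (hH.preimage continuous_snd))
    (MeasurableSet.analyticSet ?_)) ?_
  · refine MeasurableSet.inter (IsClosed.measurableSet (isClosed_eq ?_ ?_))
      (IsOpen.measurableSet (isOpen_ne_fun ?_ ?_)) <;> fun_prop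
  · fun_prop

variable [PolishSpace X] [MeasurableSpace X] [BorelSpace X]
  [CompleteSpace Y] [SecondCountableTopology Y] [MeasurableSpace Y] [BorelSpace Y]
  [CompleteSpace Z] [SecondCountableTopology Z]

/-- If the splitting of `H` were small, the part of `H` avoiding the witness would project to the
graph of a partial function. -/
theorem not_isSmall_splitting (hu : Continuous u) (hv : Continuous v) {m t : ℕ} (ht : t < m)
    {H : Set (ℕ → Z)} (hH : AnalyticSet H) (hlarge : ¬ IsSmall u v m H) :
    ¬ IsSmall u v (m + 1) (splitting u v m t H) := by
  rintro ⟨Q, hQ, hcov⟩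
  apply hlarge
  borelize Z
  have hmeas : MeasurableSet {α : ℕ → Z | ∀ i ∈ Iio m, (u (α i), v (α i)) ∉ Q} := by
    have : {α : ℕ → Z | ∀ i ∈ Iio m, (u (α i), v (α i)) ∉ Q} =
        ⋂ i ∈ Iio m, (fun α : ℕ → Z => (u (α i), v (α i))) ⁻¹' Qᶜ := by
      ext; simp
    rw [this]
    refine MeasurableSet.biInter (to_countable _) fun i _ => hQ.measurableSet.compl.preimage ?_
    have := hu.measurable
    have := hv.measurable
    fun_prop
  obtain ⟨F, hF, hWF, hinj⟩ := AnalyticSet.exists_measurableSet_graph_superset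
    ((AnalyticSet.inter hH hmeas.analyticSet).image_of_continuous
      (f := fun α => (u (α t), v (α t))) (by fun_prop)) <| by
    rintro _ ⟨α, hα, rfl⟩ _ ⟨β, hβ, rfl⟩ (h : u (α t) = u (β t))
    by_contra hne
    obtain ⟨i, hi, hiQ⟩ := hcov _ ⟨(α, β), ⟨⟨hα.1, hβ.1⟩, h, fun h' => hne (Prod.ext h h')⟩, rfl⟩
    rcases eq_or_ne i m with rfl | him
    · simp only [Function.update_self] at hiQ
      exact hβ.2 t ht hiQ
    · simp only [Function.update_of_ne him] at hiQ
      exact hα.2 i (show i < m by lia) hiQ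
  refine ⟨Q ∪ F, hQ.union (.of_graph hF hinj), fun α hα => ?_⟩
  by_cases h : ∀ i ∈ Iio m, (u (α i), v (α i)) ∉ Q
  · exact ⟨t, ht, .inr (hWF ⟨α, ⟨hα, h⟩, rfl⟩)⟩
  · push Not at h
    obtain ⟨i, hi, hiQ⟩ := h
    exact ⟨i, hi, .inl hiQ⟩

/-- `H` is an analytic large set of sequences whose first `k + 1` coordinates lie over the same
point of `X`. -/
structure IsGood (u : Z → X) (v : Z → Y) (k : ℕ) (H : Set (ℕ → Z)) : Prop where
  analyticSet : AnalyticSet H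
  large : ¬ IsSmall u v (k + 1) H
  eq : ∀ α ∈ H, ∀ i ≤ k, u (α i) = u (α 0)

/-- `H'` refines `H`: the tuples of `H'` extend those of `H` by a new point `γ (k + 1)`, which is a
possible value of the `t`-th coordinate in `H`, but whose ordinate stays away from that of `γ t`;
each coordinate varies by at most `ε` over `H'`. -/
structure Refines (v : Z → Y) (k t : ℕ) (ε : ℝ) (H H' : Set (ℕ → Z)) : Prop where
  restrict : ∀ γ ∈ H', ∃ α ∈ H, ∀ i ≤ k, γ i = α i
  new : ∀ γ ∈ H', ∃ β ∈ H, γ (k + 1) = β t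
  separated : ∃ δ > 0, ∀ γ ∈ H', δ ≤ dist (v (γ t)) (v (γ (k + 1)))
  dist_le : ∀ γ ∈ H', ∀ γ' ∈ H', ∀ i ≤ k + 1, dist (γ i) (γ' i) ≤ ε

theorem IsGood.exists_refines (hu : Continuous u) (hv : Continuous v) {k t : ℕ} (ht : t ≤ k)
    {ε : ℝ} (hε : 0 < ε) {H : Set (ℕ → Z)} (hH : IsGood u v k H) :
    ∃ H', IsGood u v (k + 1) H' ∧ Refines v k t ε H H' := by
  have hne : Nonempty Z := (nonempty_of_not_isSmall hH.large).nonempty.map (· 0)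
  have hlarge := not_isSmall_splitting hu hv (Nat.lt_succ_of_le ht) hH.analyticSet hH.large
  let K : ℕ × (Fin (k + 2) → ℕ) → Set (ℕ → Z) := fun c =>
    {γ | 1 / ((c.1 : ℝ) + 1) ≤ dist (v (γ t)) (v (γ (k + 1))) ∧
      ∀ i : Fin (k + 2), dist (γ i) (TopologicalSpace.denseSeq Z (c.2 i)) ≤ ε / 2}
  have hKc : ∀ c, IsClosed (K c) := fun c => by
    refine IsClosed.and (isClosed_le (by fun_prop) (by fun_prop)) ?_
    simp only [ofPred_forall]
    exact isClosed_iInter fun i => isClosed_le (by fun_prop) (by fun_prop)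
  obtain ⟨c, hc⟩ : ∃ c, ¬ IsSmall u v (k + 2) (splitting u v (k + 1) t H ∩ K c) := by
    by_contra! hcon
    refine hlarge (.of_iUnion hcon fun γ hγ => ?_)
    have hsep : v (γ t) ≠ v (γ (k + 1)) := by
      obtain ⟨⟨α, β⟩, ⟨-, -, h⟩, rfl⟩ := hγ
      simpa [Function.update_of_ne (show t ≠ k + 1 by lia)] using h
    obtain ⟨q, hq⟩ := exists_nat_one_div_lt (dist_pos.2 hsep)
    have := fun i : Fin (k + 2) =>
      (TopologicalSpace.denseRange_denseSeq Z).exists_dist_lt (γ i) (half_pos hε)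
    choose z hz using this
    exact mem_iUnion.2 ⟨(q, z), hγ, hq.le, fun i => (hz i).le⟩
  refine ⟨_, ⟨AnalyticSet.inter (analyticSet_splitting hu hv hH.analyticSet)
    (hKc c).analyticSet, hc, ?_⟩, ?_, ?_, ⟨1 / ((c.1 : ℝ) + 1), by positivity, ?_⟩, ?_⟩
  · rintro _ ⟨⟨⟨α, β⟩, ⟨⟨hα, hβ⟩, h, -⟩, rfl⟩, -⟩ i hi
    simp only [Function.update_of_ne (show 0 ≠ k + 1 by lia)]
    rcases eq_or_ne i (k + 1) with rfl | hik
    · rw [Function.update_self, ← h, hH.eq α hα t ht]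
    · rw [Function.update_of_ne hik, hH.eq α hα i (by lia)]
  · rintro _ ⟨⟨⟨α, β⟩, ⟨⟨hα, hβ⟩, -⟩, rfl⟩, -⟩
    exact ⟨α, hα, fun i hi => Function.update_of_ne (by lia) _ _⟩
  · rintro _ ⟨⟨⟨α, β⟩, ⟨⟨hα, hβ⟩, -⟩, rfl⟩, -⟩
    exact ⟨β, hβ, Function.update_self ..⟩
  · exact fun γ hγ => hγ.2.1
  · intro γ hγ γ' hγ' i hi
    have h₁ := hγ.2.2 ⟨i, by lia⟩
    have h₂ := hγ'.2.2 ⟨i, by lia⟩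
    have := dist_triangle_right (γ i) (γ' i) (TopologicalSpace.denseSeq Z (c.2 ⟨i, by lia⟩))
    dsimp only at h₁ h₂
    linarith

/-- If the parametrized set is not covered by countably many Borel graphs, iterating refinements
so that every coordinate is split infinitely often produces a splitting sequence. -/
theorem exists_isSplittingSequence_of_not_isSmall (hu : Continuous u) (hv : Continuous v)
    (hlarge : ¬ IsSmall u v 1 univ) : ∃ x d, IsSplittingSequence u v x d := by
  have hgood : IsGood u v 0 univ := by
    refine ⟨isClosed_univ.analyticSet, hlarge, fun α _ i hi => by rw [Nat.le_zero.1 hi]⟩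
  -- The index split at stage `k`, chosen so that each index occurs infinitely often.
  let t : ℕ → ℕ := fun k => k.unpair.1
  have ht : ∀ k, t k ≤ k := Nat.unpair_left_le
  let ε : ℕ → ℝ := fun k => 1 / ((k : ℝ) + 1)
  have hε : ∀ k, 0 < ε k := fun k => by positivity
  have hε0 : Tendsto ε atTop (𝓝 0) := tendsto_one_div_add_atTop_nhds_zero_nat
  choose next hnext href using fun k (H : {H // IsGood u v k H}) =>
    H.2.exists_refines hu hv (ht k) (hε k)
  let s : ∀ k, {H // IsGood u v k H} :=
    fun k => Nat.rec ⟨univ, hgood⟩ (fun k H => ⟨next k H, hnext k H⟩) k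
  let H : ℕ → Set (ℕ → Z) := fun k => (s k).1
  have hH : ∀ k, IsGood u v k (H k) := fun k => (s k).2
  have hHref : ∀ k, Refines v k (t k) (ε k) (H k) (H (k + 1)) := fun k => href k (s k)
  choose a ha using fun k => nonempty_of_not_isSmall (hH k).large
  have hres : ∀ k l, k ≤ l → ∀ γ ∈ H l, ∃ α ∈ H k, ∀ i ≤ k, γ i = α i := by
    intro k l hkl
    induction l, hkl using Nat.le_induction with
    | base => exact fun γ hγ => ⟨γ, hγ, fun _ _ => rfl⟩
    | succ l hkl ih =>
      intro γ hγ
      obtain ⟨α, hα, hγα⟩ := (hHref l).restrict γ hγ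
      obtain ⟨β, hβ, hαβ⟩ := ih α hα
      exact ⟨β, hβ, fun i hi => (hγα i (hi.trans hkl)).trans (hαβ i hi)⟩
  have hdist : ∀ k, ∀ i ≤ k + 1, ∀ γ ∈ H (k + 1), ∀ l ≥ k + 1, dist (a l i) (γ i) ≤ ε k := by
    intro k i hi γ hγ l hl
    obtain ⟨α, hα, h⟩ := hres (k + 1) l hl (a l) (ha l)
    rw [h i hi]
    exact (hHref k).dist_le α hα γ hγ i hi
  have hlim : ∀ i, ∃ z, Tendsto (fun l => a l i) atTop (𝓝 z) := by
    intro i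
    refine cauchySeq_tendsto_of_complete (Metric.cauchySeq_iff'.2 fun η hη => ?_)
    obtain ⟨k, hk, hik⟩ := ((hε0.eventually_lt_const hη).and (eventually_ge_atTop i)).exists
    exact ⟨k + 1, fun l hl => (hdist k i (by lia) _ (ha (k + 1)) l hl).trans_lt hk⟩
  choose d hd using hlim
  have hdd : ∀ k, ∀ i ≤ k + 1, ∀ γ ∈ H (k + 1), dist (d i) (γ i) ≤ ε k := by
    intro k i hi γ hγ
    refine le_of_tendsto ((hd i).dist tendsto_const_nhds) ?_
    filter_upwards [eventually_ge_atTop (k + 1)] with l hl using hdist k i hi γ hγ l hl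
  refine ⟨u (d 0), d, fun i => ?_, fun i q => ?_⟩
  · refine tendsto_nhds_unique ((hu.tendsto _).comp (hd i))
      (((hu.tendsto _).comp (hd 0)).congr' ?_)
    filter_upwards [eventually_ge_atTop i] with l hl
    exact ((hH l).eq _ (ha l) i hl).symm
  · have hη : (0 : ℝ) < 1 / ((q : ℝ) + 1) / 2 := by positivity
    obtain ⟨N, hN⟩ := eventually_atTop.1 (hε0.eventually_lt_const hη)
    -- A stage `k + 1` beyond `N` and `i` at which the index `i` is split.
    obtain ⟨k, hkN, hki⟩ : ∃ k ≥ N, t (k + 1) = i := by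
      refine ⟨Nat.pair i (N + 1) - 1, ?_, ?_⟩
      · have := Nat.right_le_pair i (N + 1)
        lia
      · have := Nat.right_le_pair i (N + 1)
        simp only [t]
        rw [Nat.sub_add_cancel (by lia), Nat.unpair_pair]
    have hik : i ≤ k + 1 := hki ▸ ht (k + 1)
    refine ⟨k + 2, ?_, ?_⟩
    · obtain ⟨β, hβ, hβa⟩ := (hHref (k + 1)).new _ (ha (k + 2))
      rw [hki] at hβa
      have h₁ := hdd (k + 1) (k + 2) le_rfl _ (ha (k + 2))
      have h₂ := hdd k i hik β hβ
      rw [show a (k + 2) (k + 2) = β i from hβa] at h₁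
      have h₃ := dist_triangle_right (d (k + 2)) (d i) (β i)
      have h₄ := hN k hkN
      have h₅ := hN (k + 1) (by lia)
      linarith
    · obtain ⟨δ, hδ, hsep⟩ := (hHref (k + 1)).separated
      rw [hki] at hsep
      have : δ ≤ dist (v (d i)) (v (d (k + 2))) := by
        refine ge_of_tendsto (((hv.tendsto _).comp (hd i)).dist
          ((hv.tendsto _).comp (hd (k + 2)))) ?_
        filter_upwards [eventually_ge_atTop (k + 2)] with l hl
        obtain ⟨α, hα, h⟩ := hres (k + 2) l hl (a l) (ha l)
        have := hsep α hα
        simpa [h i (by lia), h (k + 2) le_rfl] using this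
      exact fun h => (hδ.trans_le this).ne' (by rw [h, dist_self])

end Sections

section Polish

variable {X Y : Type*} [TopologicalSpace X] [PolishSpace X] [MeasurableSpace X] [BorelSpace X]
  [TopologicalSpace Y] [PolishSpace Y] [MeasurableSpace Y] [BorelSpace Y]

/-- **Lusin–Novikov for analytic sets**: an analytic set with countable sections is covered by
countably many Borel graphs. -/
theorem AnalyticSet.exists_isCountableUnionOfGraphs {P : Set (X × Y)} (hP : AnalyticSet P)
    (hc : ∀ x, {y | (x, y) ∈ P}.Countable) : ∃ Q, IsCountableUnionOfGraphs Q ∧ P ⊆ Q := by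
  obtain ⟨Z, _, _, f, hf, rfl⟩ := analyticSet_iff_exists_polishSpace_range.1 hP
  let := TopologicalSpace.upgradeIsCompletelyMetrizable Y
  let := TopologicalSpace.upgradeIsCompletelyMetrizable Z
  by_cases hsmall : IsSmall (fun z => (f z).1) (fun z => (f z).2) 1 univ
  · obtain ⟨Q, hQ, hcov⟩ := hsmall
    refine ⟨Q, hQ, ?_⟩
    rintro _ ⟨z, rfl⟩
    obtain ⟨_, -, h⟩ := hcov (fun _ => z) trivial
    exact h
  · obtain ⟨x, d, hd⟩ := exists_isSplittingSequence_of_not_isSmall (by fun_prop) (by fun_prop) hsmall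
    refine (hd.not_countable (by fun_prop) (by fun_prop) ((hc x).mono ?_)).elim
    rintro _ ⟨z, rfl, rfl⟩
    exact ⟨z, rfl⟩

/-- **Lusin–Novikov**: the projection of a Borel set with countable sections is Borel. -/
theorem measurableSet_image_fst_of_countable_sections {Q : Set (X × Y)} (hQ : MeasurableSet Q)
    (hc : ∀ x, {y | (x, y) ∈ Q}.Countable) : MeasurableSet (Prod.fst '' Q) := by
  obtain ⟨R, hR, hQR⟩ := AnalyticSet.exists_isCountableUnionOfGraphs hQ.analyticSet hc
  rw [← inter_eq_self_of_subset_left hQR]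
  exact (hR.inter hQ).measurableSet_image_fst

omit [MeasurableSpace X] [BorelSpace X] [MeasurableSpace Y] [BorelSpace Y] in
/-- The set of points over which the section of an analytic set is uncountable is analytic. -/
theorem AnalyticSet.setOf_not_countable_section {P : Set (X × Y)} (hP : AnalyticSet P) :
    AnalyticSet {x | ¬ {y | (x, y) ∈ P}.Countable} := by
  obtain ⟨Z, _, _, f, hf, rfl⟩ := analyticSet_iff_exists_polishSpace_range.1 hP
  let := TopologicalSpace.upgradeIsCompletelyMetrizable Y
  let := TopologicalSpace.upgradeIsCompletelyMetrizable Z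
  borelize Z
  let u : Z → X := fun z => (f z).1
  let v : Z → Y := fun z => (f z).2
  have hu : Continuous u := by fun_prop
  have hv : Continuous v := by fun_prop
  have hsec : ∀ x, {y | (x, y) ∈ range f} = {y | ∃ z, u z = x ∧ v z = y} := by
    intro x
    ext y
    simp [u, v, Prod.ext_iff]
  have key : {x | ¬ {y | (x, y) ∈ range f}.Countable} =
      (fun d : ℕ → Z => u (d 0)) '' {d | IsSplittingSequence u v (u (d 0)) d} := by
    ext x
    simp only [hsec]
    constructor
    · intro hx
      obtain ⟨d, hd⟩ := exists_isSplittingSequence hv hx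
      have hd0 := hd.eq 0
      subst hd0
      exact ⟨d, hd, rfl⟩
    · rintro ⟨d, hd, rfl⟩
      exact hd.not_countable hu hv
  rw [key]
  refine (MeasurableSet.analyticSet ?_).image_of_continuous (by fun_prop)
  have : {d : ℕ → Z | IsSplittingSequence u v (u (d 0)) d} = (⋂ i, {d | u (d i) = u (d 0)}) ∩
      ⋂ i, ⋂ q : ℕ, ⋃ j, {d | dist (d j) (d i) < 1 / ((q : ℝ) + 1) ∧ v (d j) ≠ v (d i)} := by
    ext d
    simp only [mem_inter_iff, mem_iInter, mem_iUnion]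
    exact ⟨fun h => ⟨h.1, h.2⟩, fun h => ⟨h.1, h.2⟩⟩
  rw [this]
  refine (MeasurableSet.iInter fun i => (isClosed_eq (by fun_prop) (by fun_prop)).measurableSet).inter
    (.iInter fun i => .iInter fun q => .iUnion fun j => IsOpen.measurableSet ?_)
  exact (isOpen_lt (by fun_prop) continuous_const).and (isOpen_ne_fun (by fun_prop) (by fun_prop))

end Polish

/-! ### Completeness for powers of a treeing -/

section Main

variable {X : Type*} [TopologicalSpace X] [PolishSpace X] [MeasurableSpace X] [BorelSpace X]
  {E : Setoid X} {G : SimpleGraph X}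

omit [TopologicalSpace X] [PolishSpace X] [MeasurableSpace X] [BorelSpace X] in
theorem CountableOn.countable_inter_class {B : Set X} (hB : CountableOn E B) (x : X) :
    {y | y ∈ B ∧ E x y}.Countable := by
  by_cases h : ∃ y ∈ B, E x y
  · obtain ⟨y, hy, hxy⟩ := h
    refine (hB y hy).mono fun z hz => ?_
    exact ⟨hz.1, E.trans (E.symm hxy) hz.2⟩
  · refine countable_empty.mono fun y hy => ?_
    exact (h ⟨y, hy⟩).elim

/-- An analytic set meeting each class of a Borel equivalence relation in a countable set has a
Borel superset with the same property. -/
theorem AnalyticSet.exists_countableOn_superset (hE : MeasurableSet {p : X × X | E p.1 p.2})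
    {A : Set X} (hA : AnalyticSet A) (hc : CountableOn E A) :
    ∃ B, MeasurableSet B ∧ A ⊆ B ∧ CountableOn E B := by
  have hP : AnalyticSet ({p : X × X | E p.1 p.2} ∩ (Prod.fst ⁻¹' A ∩ Prod.snd ⁻¹' A)) :=
    AnalyticSet.inter hE.analyticSet
      (AnalyticSet.inter (hA.preimage continuous_fst) (hA.preimage continuous_snd))
  obtain ⟨Q, hQ, hPQ⟩ := AnalyticSet.exists_isCountableUnionOfGraphs hP fun x => by
    refine (hc.countable_inter_class x).mono fun y hy => ?_
    exact ⟨hy.2.2, hy.1⟩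
  obtain ⟨B, hB, hAB, hBR⟩ := AnalyticSet.exists_measurableSet_square_subset hA
    (hE.imp hQ.measurableSet) fun p hp h => hPQ ⟨h, hp⟩
  exact ⟨B, hB, hAB, fun x hx => (hQ.countable_section x).mono fun y hy =>
    hBR (mk_mem_prod hx hy.1) hy.2⟩

/-- The pairs `(z, w)` such that `w` is the first vertex after `z` on a geodesic of length `n + 1`
from `z` to a point of `A`. -/
def firstSteps (G : SimpleGraph X) (A : Set X) (n : ℕ) : Set (X × X) :=
  {p | G.Adj p.1 p.2 ∧ ∃ a ∈ A, G.Reachable p.1 a ∧ G.dist p.1 a = n + 1 ∧ G.dist p.2 a = n}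

theorem analyticSet_firstSteps (hG : IsTreeing G E) {A : Set X} (hA : AnalyticSet A) (n : ℕ) :
    AnalyticSet (firstSteps G A n) := by
  have key : firstSteps G A n = Prod.fst '' (({q : (X × X) × X | G.Adj q.1.1 q.1.2} ∩
      ({q | G.Reachable q.1.1 q.2 ∧ G.dist q.1.1 q.2 = n + 1} ∩
        {q | G.Reachable q.1.2 q.2 ∧ G.dist q.1.2 q.2 = n})) ∩ Prod.snd ⁻¹' A) := by
    ext ⟨z, w⟩
    constructor
    · rintro ⟨hzw, a, ha, hr, h, h'⟩
      exact ⟨((z, w), a), ⟨⟨hzw, ⟨hr, h⟩, hzw.symm.reachable.trans hr, h'⟩, ha⟩, rfl⟩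
    · rintro ⟨⟨_, a⟩, ⟨⟨hzw, ⟨hr, h⟩, -, h'⟩, ha⟩, rfl⟩
      exact ⟨hzw, a, ha, hr, h, h'⟩
  rw [key]
  refine (AnalyticSet.inter (MeasurableSet.analyticSet ?_)
    (hA.preimage continuous_snd)).image_of_continuous continuous_fst
  exact (hG.borel.preimage measurable_fst).inter
    (((hG.measurableSet_dist_eq (n + 1)).preimage
      (f := fun q : (X × X) × X => (q.1.1, q.2)) (by fun_prop)).inter
    ((hG.measurableSet_dist_eq n).preimage
      (f := fun q : (X × X) × X => (q.1.2, q.2)) (by fun_prop)))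

omit [TopologicalSpace X] [PolishSpace X] [MeasurableSpace X] [BorelSpace X] in
/-- A vertex with uncountably many first steps towards `A` belongs to every countable set which is
complete for its class: any other centre only serves the branch in which it lies. -/
theorem mem_of_not_countable_firstSteps (hG : G.IsAcyclic) {A C : Set X} {n : ℕ} {z : X}
    (hC : C.Countable) (hcomp : ∀ a ∈ A, G.Reachable z a →
      ∃ c ∈ C, G.Reachable a c ∧ G.dist a c ≤ n + 1)
    (hz : ¬ {w | (z, w) ∈ firstSteps G A n}.Countable) : z ∈ C := by
  by_contra hzC
  have hpick : ∀ w ∈ {w | (z, w) ∈ firstSteps G A n},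
      ∃ c ∈ C, G.Reachable z c ∧ G.dist z c = G.dist w c + 1 := by
    rintro w ⟨hzw, a, ha, hr, hza, hwa⟩
    dsimp only at *
    obtain ⟨c, hc, hac, hd⟩ := hcomp a ha hr
    have hzc := hr.trans hac
    refine ⟨c, hc, hzc, (dist_eq_add_one_or hG hzw hzc).resolve_right fun h => ?_⟩
    have h₁ := dist_add_dist_le_of_opposite_sides hG hzw hr hzc (by lia) h
    have h₂ := hzc.pos_dist_of_ne fun h => hzC (h ▸ hc)
    lia
  choose! c hcC hzc hdist using hpick
  refine hz (MapsTo.countable_of_injOn (f := c) hcC (fun w hw w' hw' h => ?_) hC)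
  refine eq_of_dist_eq_add_one hG hw.1 hw'.1 (hzc w hw) (hdist w hw) ?_
  rw [h]
  exact hdist w' hw'

theorem IsTreeing.measurableSet_dist_le_of_countableOn (hG : IsTreeing G E) {B : Set X}
    (hB : MeasurableSet B) (hc : CountableOn E B) (n : ℕ) :
    MeasurableSet {y | ∃ z ∈ B, G.Reachable y z ∧ G.dist y z ≤ n} := by
  have hm : MeasurableSet ((⋃ k ∈ Iic n, {p : X × X | G.Reachable p.1 p.2 ∧
      G.dist p.1 p.2 = k}) ∩ Prod.snd ⁻¹' B) :=
    (MeasurableSet.biUnion (to_countable _) fun k _ => hG.measurableSet_dist_eq k).inter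
      (hB.preimage measurable_snd)
  convert measurableSet_image_fst_of_countable_sections hm fun x => ?_ using 1
  · ext y
    constructor
    · rintro ⟨z, hz, hr, hd⟩
      exact ⟨(y, z), ⟨mem_iUnion₂.2 ⟨_, hd, hr, rfl⟩, hz⟩, rfl⟩
    · rintro ⟨⟨_, z⟩, ⟨h, hz⟩, rfl⟩
      obtain ⟨k, hk, hr, rfl⟩ := mem_iUnion₂.1 h
      exact ⟨z, hz, hr, hk⟩
  · refine (hc.countable_inter_class x).mono fun y hy => ?_
    obtain ⟨k, -, hr, -⟩ := mem_iUnion₂.1 hy.1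
    exact ⟨hy.2, (hG.reachable_iff x y).1 hr⟩

omit [TopologicalSpace X] [PolishSpace X] [MeasurableSpace X] [BorelSpace X] in
theorem CountableOn.union {B B' : Set X} (hB : CountableOn E B) (hB' : CountableOn E B') :
    CountableOn E (B ∪ B') := fun x _ =>
  ((hB.countable_inter_class x).union (hB'.countable_inter_class x)).mono fun _ hy =>
    hy.1.imp (⟨·, hy.2⟩) (⟨·, hy.2⟩)

/-- The theorem in terms of the graph distance, by induction on the radius. -/
theorem exists_countableOn_of_dist_le (hE : MeasurableSet {p : X × X | E p.1 p.2})
    (hG : IsTreeing G E) (n : ℕ) {A : Set X} (hA : AnalyticSet A)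
    (h : ∀ x ∈ A, ∃ C : Set X, C.Countable ∧
      ∀ a ∈ A, G.Reachable x a → ∃ c ∈ C, G.Reachable a c ∧ G.dist a c ≤ n) :
    ∃ B : Set X, MeasurableSet B ∧ CountableOn E B ∧
      ∀ a ∈ A, ∃ b ∈ B, G.Reachable a b ∧ G.dist a b ≤ n := by
  induction n generalizing A with
  | zero =>
    obtain ⟨B, hB, hAB, hBc⟩ := AnalyticSet.exists_countableOn_superset hE hA fun x hx => by
      obtain ⟨C, hC, hcov⟩ := h x hx
      refine hC.mono fun a ha => ?_
      obtain ⟨c, hc, hac, hd⟩ := hcov a ha.1 ((hG.reachable_iff x a).2 ha.2)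
      rwa [hac.dist_eq_zero_iff.1 (Nat.le_zero.1 hd)]
    exact ⟨B, hB, hBc, fun a ha => ⟨a, hAB ha, .refl a, by simp⟩⟩
  | succ n ih =>
    let U : Set X := {z | ¬ {w | (z, w) ∈ firstSteps G A n}.Countable}
    have hU : AnalyticSet U :=
      AnalyticSet.setOf_not_countable_section (analyticSet_firstSteps hG hA n)
    have hUc : CountableOn E U := by
      intro z hz
      have hne : {w | (z, w) ∈ firstSteps G A n}.Nonempty := by
        rw [nonempty_iff_ne_empty]
        intro h0
        exact hz (h0 ▸ countable_empty)
      obtain ⟨w, -, a, ha, hza, -⟩ := hne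
      obtain ⟨C, hC, hcov⟩ := h a ha
      refine hC.mono fun y hy => mem_of_not_countable_firstSteps hG.acyclic hC ?_ hy.1
      exact fun b hb hyb => hcov b hb <|
        hza.symm.trans (((hG.reachable_iff z y).2 hy.2).trans hyb)
    obtain ⟨B₁, hB₁, hUB₁, hB₁c⟩ := AnalyticSet.exists_countableOn_superset hE hU hUc
    let N : Set X := {y | ∃ z ∈ B₁, G.Reachable y z ∧ G.dist y z ≤ n + 1}
    have hN : MeasurableSet N := hG.measurableSet_dist_le_of_countableOn hB₁ hB₁c (n + 1)
    obtain ⟨B₂, hB₂, hB₂c, hcov₂⟩ := ih (A := A \ N)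
      (AnalyticSet.inter hA hN.compl.analyticSet) <| by
      rintro x ⟨hx, -⟩
      obtain ⟨C, hC, hcov⟩ := h x hx
      -- Points at distance exactly `n + 1` from `c ∈ C` are served by their first steps from `c`.
      refine ⟨C ∪ ⋃ c ∈ C, {w | (c, w) ∈ firstSteps G (A \ N) n},
        hC.union (hC.biUnion fun c _ => ?_), ?_⟩
      · by_cases hc : c ∈ U
        · refine countable_empty.mono ?_
          rintro w ⟨-, a, ⟨-, haN⟩, hr, hd, -⟩
          exact haN ⟨c, hUB₁ hc, hr.symm, by rw [G.dist_comm]; exact hd.le⟩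
        · refine (not_not.1 hc).mono ?_
          rintro w ⟨hcw, a, ⟨ha, -⟩, hd⟩
          exact ⟨hcw, a, ha, hd⟩
      · rintro a ⟨ha, haN⟩ hxa
        obtain ⟨c, hc, hac, hd⟩ := hcov a ha hxa
        rcases Nat.le_succ_iff.1 hd with hd | hd
        · exact ⟨c, .inl hc, hac, hd⟩
        · rw [G.dist_comm] at hd
          obtain ⟨w, hcw, hwa⟩ := exists_adj_dist_eq_add_one hac.symm hd
          refine ⟨w, .inr (mem_iUnion₂.2 ⟨c, hc, hcw, a, ⟨ha, haN⟩, hac.symm, hd, hwa⟩),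
            hac.trans hcw.reachable, ?_⟩
          rw [G.dist_comm, hwa]
    refine ⟨B₁ ∪ B₂, hB₁.union hB₂, hB₁c.union hB₂c, fun a ha => ?_⟩
    by_cases haN : a ∈ N
    · obtain ⟨z, hz, hr⟩ := haN
      exact ⟨z, .inl hz, hr⟩
    · obtain ⟨b, hb, hr, hd⟩ := hcov₂ a ⟨ha, haN⟩
      exact ⟨b, .inr hb, hr, hd.trans n.le_succ⟩

end Main

end BorelTreeing

theorem mainTheorem8 {X : Type*} [TopologicalSpace X] [PolishSpace X] [MeasurableSpace X]
    [BorelSpace X] (A : Set X) (hA : MeasureTheory.AnalyticSet A)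
    (E : Setoid X) (hE : MeasurableSet {p : X × X | E p.1 p.2})
    (G : SimpleGraph X) (hG : BorelTreeing.IsTreeing G E) (n : ℕ)
    (h : ∀ x ∈ A, ∃ C : Set X, C.Countable ∧ C ⊆ {y | E x y} ∧
      BorelTreeing.CompleteFor (BorelTreeing.IterateLE G.Adj n) {y | y ∈ A ∧ E x y} C) :
    ∃ B : Set X, MeasurableSet B ∧ BorelTreeing.CountableOn E B ∧
      BorelTreeing.CompleteFor (BorelTreeing.IterateLE G.Adj n) A B := by
  simp only [BorelTreeing.CompleteFor, BorelTreeing.iterateLE_adj_iff] at h ⊢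
  refine BorelTreeing.exists_countableOn_of_dist_le hE hG n hA fun x hx => ?_
  obtain ⟨C, hC, -, hcov⟩ := h x hx
  exact ⟨C, hC, fun a ha hxa => hcov a ⟨ha, (hG.reachable_iff x a).1 hxa⟩⟩
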